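/- Let $\mathcal A$ be a finite-dimensional real vector space with a bilinear, associative, commutative multiplication $\star$ that has a unit $\mathbb 1$, and let $\|\cdot\|$ be any norm on $\mathcal A$. A function $f$ is $\mathcal A$-differentiable at $p$ if it has a real Fréchet differential $d_pf$ at $p$ with $d_pf(v\star w)=d_pf(v)\star w$ for all $v,w\in\mathcal A$; its derivative is then $\frac{df}{d\zeta}(p)=d_pf(\mathbb 1)$. For a rectifiable curve $C$ parametrized by a continuous $\gamma:[0,1]\to\mathcal A$, the integral is $$\int_C f(\eta)\star d\eta=\lim \sum_{i=1}^m f(\gamma(t_i))\star\bigl(\gamma(t_i)-\gamma(t_{i-1})\bigr),$$ where the limit is over partitions $0=t_0\le t_1\le\dots\le t_m=1$ whose mesh tends to $0$. Theorem (FTC I for $\mathcal A$-calculus). Let $U\subseteq\mathcal A$ be open and simply connected, let $f$ be $\mathcal A$-differentiable at every point of $U$, and let $\zeta_o\in U$. Every $\zeta\in U$ can be joined to $\zeta_o$ by a continuously differentiable (hence rectifiable) curve in $U$. For every $\zeta \in U$ and every rectifiable curve $C$ in $U$ from $\zeta_o$ to $\zeta$ (in particular for every rectifiable differentiable one), the integral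 $\int_C f(\eta)\star d\eta$ exists and its value depends only on $\zeta$, not on $C$. As a function of $\zeta\in U$ it is $\mathcal A$-differentiable, and $$\frac{d}{d\zeta}\int_C f(\eta)\star d\eta=f(\zeta)\qquad\text{for all }\zeta\in U.$$ -/

import Mathlib

/-- A commutative unital ring whose additive group carries a norm. No compatibility between the
norm and the multiplication is required: in finite dimension a bilinear multiplication is
automatically continuous, and the norm need not be submultiplicative. -/
class NormedGroupCommRing (A : Type*) extends CommRing A, NormedAddCommGroup A

section AlgebraCalculus

variable {A : Type*} [NormedGroupCommRing A] [NormedSpace ℝ A]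

/-- `f` is `A`-differentiable at `p` with `A`-derivative `c`: the real Fréchet differential `T` of
`f` at `p` exists, is right-`A`-linear, and the derivative is the element `T 1` of `A`. -/
def HasAlgDerivAt (f : A → A) (c p : A) : Prop :=
  ∃ T : A →L[ℝ] A, HasFDerivAt f T p ∧ (∀ v w : A, T (v * w) = T v * w) ∧ T 1 = c

/-- `f` is `A`-differentiable at `p`: it has a right-`A`-linear real Fréchet differential at `p`. -/
def AlgDifferentiableAt (f : A → A) (p : A) : Prop :=
  ∃ T : A →L[ℝ] A, HasFDerivAt f T p ∧ ∀ v w : A, T (v * w) = T v * w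

/-- A curve (a continuous path, parametrized by `[0, 1]`) is rectifiable if it has finite length,
i.e. the lengths of its inscribed polygons are bounded. -/
def IsRectifiable {P Q : A} (γ : Path P Q) : Prop :=
  BoundedVariationOn (γ : unitInterval → A) Set.univ

/-- A curve lies in the set `U`. -/
def CurveIn {P Q : A} (γ : Path P Q) (U : Set A) : Prop :=
  ∀ t : unitInterval, γ t ∈ U

/-- The Riemann sum `∑ f (ζ i) * (ζ i - ζ (i - 1))`, `i = 1, …, m`, over the points
`ζ i = γ (t i)` of the curve. -/
noncomputable def riemannSum (f : A → A) {P Q : A} (γ : Path P Q) {m : ℕ}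
    (t : Fin (m + 1) → unitInterval) : A :=
  ∑ i : Fin m, f (γ (t i.succ)) * (γ (t i.succ) - γ (t i.castSucc))

/-- The integral `∫_C f(ζ) ⋆ dζ` exists and equals `I`: the Riemann sums over partitions
`0 = t 0 ≤ t 1 ≤ ⋯ ≤ t m = 1` converge to `I` as the mesh tends to `0`. -/
def HasCurveIntegral (f : A → A) {P Q : A} (γ : Path P Q) (I : A) : Prop :=
  ∀ ε > 0, ∃ δ > 0, ∀ (m : ℕ) (t : Fin (m + 1) → unitInterval), Monotone t → t 0 = 0 →
    t (Fin.last m) = 1 → (∀ i : Fin m, (t i.succ : ℝ) - (t i.castSucc : ℝ) < δ) →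
    ‖riemannSum f γ t - I‖ < ε

end AlgebraCalculus

open Set Filter Topology

/-! ### Gluing local primitives. -/

section Gluing

/-! Since `df` is `A`-linear and `⋆` commutes, `df(v) ⋆ w = df(v ⋆ w) = df(w) ⋆ v`: the form `f ⋆
dη` is closed, hence exact on balls. Local primitives differ by locally constant functions, so
simple connectedness glues them to a primitive `F` on `U`. As `f` is continuous, `F` is strictly
differentiable; by compactness each term of a fine Riemann sum is an increment of `F` up to `ε`
times the chord, and rectifiability bounds the total error. -/

/-- On a simply connected, locally path-connected space, functions prescribed locally up to locally
constant functions can be glued to a global function. -/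
theorem exists_eventually_sub_eq_of_simplyConnected {X G : Type*} [TopologicalSpace X]
    [SimplyConnectedSpace X] [LocallyPathConnectedSpace X] [AddCommGroup G]
    (V : X → Set X) (hVo : ∀ i, IsOpen (V i)) (hV : ∀ i, i ∈ V i) (P : X → X → G)
    (hP : ∀ i j, ∀ x ∈ V i ∩ V j, ∀ᶠ y in 𝓝 x, P i y - P j y = P i x - P j x) :
    ∃ F : X → G, ∀ x, ∀ᶠ y in 𝓝 x, F y - P x y = F x - P x x := by
  let : TopologicalSpace G := ⊥
  have : DiscreteTopology G := ⟨rfl⟩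
  -- Locally constant translations glue discrete fibres, so the total space covers `X`. A global
  -- section is a coherent choice of integration constants.
  let Z : FiberBundleCore X X G :=
    { baseSet := V
      isOpen_baseSet := hVo
      indexAt := id
      mem_baseSet_at := hV
      coordChange := fun i j x a ↦ a + (P i x - P j x)
      coordChange_self := fun i x _ v ↦ by simp
      continuousOn_coordChange := fun i j ↦ by
        refine continuousOn_snd.add fun p hp ↦ ContinuousAt.continuousWithinAt ?_
        refine ContinuousAt.comp (f := Prod.fst) (g := fun x ↦ P i x - P j x) ?_ continuousAt_fst
        exact continuousAt_const.congr ((hP i j p.1 hp.1).mono fun y hy ↦ hy.symm)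
      coordChange_comp := fun i j k x _ v ↦ by abel }
  have hcov : IsCoveringMap Z.proj := FiberBundle.isCoveringMap
  obtain ⟨x₀⟩ : Nonempty X := inferInstance
  obtain ⟨s, ⟨-, hs⟩, -⟩ := hcov.existsUnique_continuousMap_lifts (ContinuousMap.id X) x₀
    (⟨x₀, (0 : G)⟩ : Z.TotalSpace) rfl
  have hs' (x : X) : (s x).1 = x := congrFun hs x
  let a (x : X) : G := (s x).2
  -- `a x` is the section's coordinate in the chart indexed by `x` itself; its continuity in a fixed
  -- chart says that `F - P x` is locally constant.
  refine ⟨fun x ↦ a x + P x x, fun x ↦ ?_⟩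
  have hcont : ContinuousAt (fun y ↦ (Z.localTriv x (s y)).2) x := by
    refine continuousAt_snd.comp (ContinuousAt.comp ?_ s.continuous.continuousAt)
    refine (Z.localTriv x).continuousOn_toFun.continuousAt
      ((Z.localTriv x).open_source.mem_nhds ?_)
    rw [(Z.localTriv x).mem_source]
    change (s x).1 ∈ V x
    rw [hs']
    exact hV x
  have hval (y : X) : (Z.localTriv x (s y)).2 = a y + (P y y - P x y) := by
    change a y + (P (s y).1 (s y).1 - P x (s y).1) = _
    rw [hs']
  filter_upwards [hcont.eventually_mem ((isOpen_discrete {(Z.localTriv x (s x)).2}).mem_nhds rfl)]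
    with y hy
  have hy' := mem_singleton_iff.1 hy
  rw [hval, hval] at hy'
  rw [add_sub_assoc, add_sub_assoc, hy']

/-- A locally exact `1`-form on a simply connected open set is exact. -/
theorem IsSimplyConnected.exists_forall_hasFDerivAt {E F : Type*} [NormedAddCommGroup E]
    [NormedSpace ℝ E] [NormedAddCommGroup F] [NormedSpace ℝ F] {U : Set E}
    (hUc : IsSimplyConnected U) (hUo : IsOpen U) {ω : E → E →L[ℝ] F}
    (hω : ∀ x ∈ U, ∃ r > 0, ∃ g : E → F, ∀ y ∈ Metric.ball x r, HasFDerivAt g (ω y) y) :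
    ∃ g : E → F, ∀ x ∈ U, HasFDerivAt g (ω x) x := by
  have := hUc.simplyConnectedSpace
  have := hUo.locallyPathConnectedSpace
  choose! r hr g hg using hω
  obtain ⟨G, hG⟩ := exists_eventually_sub_eq_of_simplyConnected (X := U) (G := F)
    (fun i ↦ Subtype.val ⁻¹' Metric.ball (i : E) (r i))
    (fun i ↦ Metric.isOpen_ball.preimage continuous_subtype_val)
    (fun i ↦ Metric.mem_ball_self (hr i i.2)) (fun i x ↦ g i x) fun i j x hx ↦ by
      have hB : IsOpen (Metric.ball (i : E) (r i) ∩ Metric.ball (j : E) (r j)) :=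
        Metric.isOpen_ball.inter Metric.isOpen_ball
      filter_upwards [continuous_subtype_val.continuousAt.eventually_mem (hB.mem_nhds hx)] with y hy
      have hd : ∀ z ∈ Metric.ball (i : E) (r i) ∩ Metric.ball (j : E) (r j),
          HasFDerivAt (fun z ↦ g i z - g j z) (0 : E →L[ℝ] F) z := fun z hz ↦ by
        simpa using (hg i i.2 z hz.1).fun_sub (hg j j.2 z hz.2)
      refine ((convex_ball _ _).inter (convex_ball _ _)).is_const_of_fderivWithin_eq_zero
        (𝕜 := ℝ) (f := fun z ↦ g i z - g j z)
        (fun z hz ↦ (hd z hz).differentiableAt.differentiableWithinAt) (fun z hz ↦ ?_) hy hx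
      rw [fderivWithin_of_isOpen hB hz, (hd z hz).fderiv]
  classical
  refine ⟨fun x ↦ if hx : x ∈ U then G ⟨x, hx⟩ else 0, fun x hx ↦ ?_⟩
  have hx' := hG ⟨x, hx⟩
  rw [nhds_subtype_eq_comap, eventually_comap] at hx'
  refine ((hg x hx x (Metric.mem_ball_self (hr x hx))).const_add
    (G ⟨x, hx⟩ - g x x)).congr_of_eventuallyEq ?_
  filter_upwards [hx', hUo.mem_nhds hx] with y hy hyU
  rw [dif_pos hyU, ← hy ⟨y, hyU⟩ rfl, sub_add_cancel]

end Gluing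

/-! ### Joining points by `C¹` curves. -/

section SmoothPaths

variable {E : Type*} [NormedAddCommGroup E] [NormedSpace ℝ E]

/-- `x` and `y` are the endpoints of a continuously differentiable curve in `U` which is constant
outside the unit interval. -/
def JoinedBySmoothCurve (U : Set E) (x y : E) : Prop :=
  ∃ g : ℝ → E, ContDiff ℝ 1 g ∧ (∀ t ≤ 0, g t = x) ∧ (∀ t, 1 ≤ t → g t = y) ∧ ∀ t, g t ∈ U

theorem JoinedBySmoothCurve.trans {U : Set E} {x y z : E} (h₁ : JoinedBySmoothCurve U x y)
    (h₂ : JoinedBySmoothCurve U y z) : JoinedBySmoothCurve U x z := by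
  obtain ⟨g, hg, hg0, hg1, hgU⟩ := h₁
  obtain ⟨k, hk, hk0, hk1, hkU⟩ := h₂
  -- At each time one summand is stationary, so a sum of globally `C¹` maps replaces piecewise
  -- concatenation.
  refine ⟨fun t ↦ g (2 * t) + (k (2 * t - 1) - y), ?_, fun t ht ↦ ?_, fun t ht ↦ ?_, fun t ↦ ?_⟩
  · fun_prop
  · simp [hg0 (2 * t) (by linarith), hk0 (2 * t - 1) (by linarith)]
  · simp [hg1 (2 * t) (by linarith), hk1 (2 * t - 1) (by linarith)]
  · rcases le_total (2 * t) 1 with h | h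
    · simpa [hk0 (2 * t - 1) (by linarith)] using hgU (2 * t)
    · simpa [hg1 (2 * t) h] using hkU (2 * t - 1)

theorem JoinedBySmoothCurve.of_segment_subset {U : Set E} {x y : E} (h : segment ℝ x y ⊆ U) :
    JoinedBySmoothCurve U x y := by
  refine ⟨fun t ↦ x + Real.smoothTransition t • (y - x), ?_, fun t ht ↦ ?_, fun t ht ↦ ?_,
    fun t ↦ h ?_⟩
  · have := Real.smoothTransition.contDiff (n := 1)
    fun_prop
  · simp [Real.smoothTransition.zero_of_nonpos ht]
  · simp [Real.smoothTransition.one_of_one_le ht]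
  · rw [segment_eq_image']
    exact ⟨_, ⟨Real.smoothTransition.nonneg t, Real.smoothTransition.le_one t⟩, rfl⟩

theorem IsPreconnected.joinedBySmoothCurve {U : Set E} (hU : IsPreconnected U) (hUo : IsOpen U)
    {x y : E} (hx : x ∈ U) (hy : y ∈ U) : JoinedBySmoothCurve U x y := by
  refine hU.induction₂' (JoinedBySmoothCurve U) (fun p hp ↦ ?_)
    (fun _ _ _ _ _ _ ↦ JoinedBySmoothCurve.trans) hx hy
  obtain ⟨r, hr, hrU⟩ := Metric.isOpen_iff.1 hUo p hp
  refine eventually_nhdsWithin_of_eventually_nhds ?_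
  filter_upwards [Metric.ball_mem_nhds p hr] with q hq
  have hpq : segment ℝ p q ⊆ U :=
    ((convex_ball p r).segment_subset (Metric.mem_ball_self hr) hq).trans hrU
  exact ⟨.of_segment_subset hpq, .of_segment_subset (segment_symm ℝ p q ▸ hpq)⟩

theorem exists_path_contDiffOn {U : Set E} (hU : IsPreconnected U) (hUo : IsOpen U)
    {x y : E} (hx : x ∈ U) (hy : y ∈ U) :
    ∃ γ : Path x y, ContDiffOn ℝ 1 γ.extend (Icc 0 1) ∧
      BoundedVariationOn (γ : unitInterval → E) univ ∧ ∀ t, γ t ∈ U := by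
  obtain ⟨g, hg, hg0, hg1, hgU⟩ := hU.joinedBySmoothCurve hUo hx hy
  let γ : Path x y :=
    { toFun := fun t ↦ g t
      continuous_toFun := hg.continuous.comp continuous_subtype_val
      source' := hg0 _ le_rfl
      target' := hg1 _ le_rfl }
  refine ⟨γ, hg.contDiffOn.congr fun t ht ↦ γ.extend_apply ht, ?_, fun t ↦ hgU t⟩
  obtain ⟨K, hK⟩ := hg.contDiffOn.exists_lipschitzOnWith one_ne_zero (convex_Icc (0 : ℝ) 1)
    isCompact_Icc
  refine hK.comp_boundedVariationOn (f := g) (g := Subtype.val) (fun t _ ↦ t.2) ?_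
  exact MonotoneOn.boundedVariationOn (C := 1) (fun _ _ _ _ h ↦ h)
    fun t _ ↦ abs_le.2 ⟨by linarith [t.2.1], t.2.2⟩

end SmoothPaths

/-! ### Integration in the algebra. -/

section AlgebraCalculus

variable {A : Type*} [NormedGroupCommRing A]

theorem IsRectifiable.exists_sum_norm_le {P Q : A} {γ : Path P Q} (hγ : IsRectifiable γ) :
    ∃ L : ℝ, 0 ≤ L ∧ ∀ (m : ℕ) (t : Fin (m + 1) → unitInterval), Monotone t →
      ∑ i : Fin m, ‖γ (t i.succ) - γ (t i.castSucc)‖ ≤ L := by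
  refine ⟨(eVariationOn (γ : unitInterval → A) univ).toReal, ENNReal.toReal_nonneg,
    fun m t ht ↦ ?_⟩
  -- Truncating the index makes the partition a monotone sequence on `ℕ`.
  let u : ℕ → unitInterval := fun i ↦ t ⟨min i m, by omega⟩
  have hu : Monotone u := fun i j hij ↦ ht (Fin.mk_le_mk.2 (min_le_min_right m hij))
  have hsum := eVariationOn.sum_le (f := (γ : unitInterval → A)) (s := univ) (n := m) hu
    fun _ ↦ mem_univ _
  rw [← ENNReal.ofReal_le_iff_le_toReal hγ]
  refine le_trans (le_of_eq ?_) hsum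
  rw [ENNReal.ofReal_sum_of_nonneg fun _ _ ↦ norm_nonneg _, ← Fin.sum_univ_eq_sum_range
    (fun i ↦ edist (γ (u (i + 1))) (γ (u i)))]
  refine Finset.sum_congr rfl fun i _ ↦ ?_
  have h1 : u (i + 1) = t i.succ := congrArg t (Fin.ext (by simp))
  have h2 : u i = t i.castSucc := congrArg t (Fin.ext (by simp))
  rw [h1, h2, edist_dist, dist_eq_norm]

variable [NormedSpace ℝ A]

theorem AlgDifferentiableAt.continuousAt {f : A → A} {p : A} (hf : AlgDifferentiableAt f p) :
    ContinuousAt f p :=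
  hf.choose_spec.1.continuousAt

variable [IsScalarTower ℝ A A] [SMulCommClass ℝ A A] [FiniteDimensional ℝ A]

variable (A) in
/-- The multiplication of a finite-dimensional real algebra as a continuous bilinear map. -/
noncomputable def continuousMul : A →L[ℝ] A →L[ℝ] A :=
  LinearMap.toContinuousLinearMap
    (LinearMap.toContinuousLinearMap.toLinearMap ∘ₗ LinearMap.mul ℝ A)

@[simp]
theorem continuousMul_apply (a b : A) : continuousMul A a b = a * b := rfl

/-- The `1`-form `f(η) ⋆ dη` of an algebra-differentiable function on a ball is exact. -/
theorem exists_hasFDerivAt_continuousMul_of_ball {f : A → A} {x : A} {r : ℝ}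
    (hf : ∀ p ∈ Metric.ball x r, AlgDifferentiableAt f p) :
    ∃ g : A → A, ∀ y ∈ Metric.ball x r, HasFDerivAt g (continuousMul A (f y)) y := by
  have : CompleteSpace A := FiniteDimensional.complete ℝ A
  have hd (p) (hp : p ∈ Metric.ball x r) : ∃ T : A →L[ℝ] A,
      HasFDerivAt (fun y ↦ continuousMul A (f y)) ((continuousMul A).comp T) p ∧
        ∀ v w : A, T (v * w) = T v * w := by
    obtain ⟨T, hT, hmul⟩ := hf p hp
    exact ⟨T, (continuousMul A).hasFDerivAt.comp p hT, hmul⟩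
  refine (convex_ball x r).exists_forall_hasFDerivAt_of_fderiv_symmetric Metric.isOpen_ball
    (fun p hp ↦ ?_) fun p hp v w ↦ ?_
  · obtain ⟨T, hT, -⟩ := hd p hp
    exact hT.differentiableAt.differentiableWithinAt
  · obtain ⟨T, hT, hmul⟩ := hd p hp
    rw [hT.fderiv]
    change T v * w = T w * v
    rw [← hmul, ← hmul, mul_comm]

theorem hasAlgDerivAt_of_hasFDerivAt {F : A → A} {c p : A}
    (h : HasFDerivAt F (continuousMul A c) p) : HasAlgDerivAt F c p :=
  ⟨continuousMul A c, h, fun v w ↦ (mul_assoc c v w).symm, mul_one c⟩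

/-- Along a curve, the increments of a primitive are uniformly approximated by the terms of the
Riemann sums. -/
theorem exists_forall_dist_lt_norm_sub_le {F f : A → A} {P Q : A} (γ : Path P Q)
    (hF : ∀ t, HasStrictFDerivAt F (continuousMul A (f (γ t))) (γ t))
    (hf : ∀ t, ContinuousAt f (γ t)) {ε : ℝ} (hε : 0 < ε) :
    ∃ δ > 0, ∀ s t : unitInterval, dist s t < δ →
      ‖f (γ s) * (γ s - γ t) - (F (γ s) - F (γ t))‖ ≤ ε * ‖γ s - γ t‖ := by
  suffices h : ∀ᶠ p : unitInterval × unitInterval in uniformity unitInterval,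
      ‖f (γ p.1) * (γ p.1 - γ p.2) - (F (γ p.1) - F (γ p.2))‖ ≤ ε * ‖γ p.1 - γ p.2‖ by
    obtain ⟨δ, hδ, h⟩ := Metric.mem_uniformity_dist.1 h
    exact ⟨δ, hδ, fun s t hst ↦ h hst⟩
  -- Compactness reduces a uniform `δ` to estimates near each diagonal point `(t, t)`.
  rw [compactSpace_uniformity, eventually_iSup]
  intro t
  have hγ : Tendsto (fun p : unitInterval × unitInterval ↦ (γ p.1, γ p.2)) (𝓝 (t, t))
      (𝓝 (γ t, γ t)) :=
    (γ.continuous.prodMap γ.continuous).tendsto (t, t)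
  have h1 := hγ.eventually ((hF t).isLittleO.def (half_pos hε))
  have h2 : ∀ᶠ p : unitInterval × unitInterval in 𝓝 (t, t),
      ‖continuousMul A (f (γ p.1)) - continuousMul A (f (γ t))‖ < ε / 2 := by
    have hc : ContinuousAt (fun p : unitInterval × unitInterval ↦ continuousMul A (f (γ p.1)))
        (t, t) := by
      refine (continuousMul A).continuous.continuousAt.comp ?_
      exact ContinuousAt.comp (f := fun p : unitInterval × unitInterval ↦ γ p.1) (hf t)
        (γ.continuous.continuousAt.comp continuousAt_fst)
    filter_upwards [hc.eventually_mem (Metric.ball_mem_nhds _ (half_pos hε))] with p hp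
    rwa [← dist_eq_norm]
  filter_upwards [h1, h2] with p hp1 hp2
  have hp3 := (continuousMul A (f (γ p.1)) - continuousMul A (f (γ t))).le_of_opNorm_le
    hp2.le (γ p.1 - γ p.2)
  calc ‖f (γ p.1) * (γ p.1 - γ p.2) - (F (γ p.1) - F (γ p.2))‖
      = ‖(continuousMul A (f (γ p.1)) - continuousMul A (f (γ t))) (γ p.1 - γ p.2)
        - (F (γ p.1) - F (γ p.2) - continuousMul A (f (γ t)) (γ p.1 - γ p.2))‖ := by
        congr 1
        change _ = f (γ p.1) * (γ p.1 - γ p.2) - f (γ t) * (γ p.1 - γ p.2) -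
          (F (γ p.1) - F (γ p.2) - f (γ t) * (γ p.1 - γ p.2))
        abel
    _ ≤ ε / 2 * ‖γ p.1 - γ p.2‖ + ε / 2 * ‖γ p.1 - γ p.2‖ :=
        (norm_sub_le _ _).trans (add_le_add hp3 hp1)
    _ = ε * ‖γ p.1 - γ p.2‖ := by ring

/-- The integral of a function with a primitive along a rectifiable curve is the increment of the
primitive. -/
theorem hasCurveIntegral_of_hasStrictFDerivAt {F f : A → A} {P Q : A} {γ : Path P Q}
    (hγ : IsRectifiable γ) (hF : ∀ t, HasStrictFDerivAt F (continuousMul A (f (γ t))) (γ t))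
    (hf : ∀ t, ContinuousAt f (γ t)) : HasCurveIntegral f γ (F Q - F P) := by
  intro ε hε
  obtain ⟨L, hL, hsum⟩ := hγ.exists_sum_norm_le
  obtain ⟨δ, hδ, h⟩ := exists_forall_dist_lt_norm_sub_le γ hF hf
    -- `L + 1` covers `L = 0` and makes the final bound strict.
    (show 0 < ε / (L + 1) by positivity)
  refine ⟨δ, hδ, fun m t ht h0 h1 hmesh ↦ ?_⟩
  have htel : F Q - F P = ∑ i : Fin m, (F (γ (t i.succ)) - F (γ (t i.castSucc))) := by
    have := Fin.sum_univ_succ (fun i ↦ F (γ (t i)))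
    rw [Fin.sum_univ_castSucc, h0, h1, γ.source, γ.target] at this
    rw [Finset.sum_sub_distrib, sub_eq_sub_iff_add_eq_add, add_comm, this, add_comm]
  rw [riemannSum, htel, ← Finset.sum_sub_distrib]
  calc ‖∑ i : Fin m, (f (γ (t i.succ)) * (γ (t i.succ) - γ (t i.castSucc))
        - (F (γ (t i.succ)) - F (γ (t i.castSucc))))‖
      ≤ ∑ i : Fin m, ε / (L + 1) * ‖γ (t i.succ) - γ (t i.castSucc)‖ := by
        refine norm_sum_le_of_le _ fun i _ ↦ h _ _ ?_
        rw [Subtype.dist_eq, Real.dist_eq, abs_of_nonneg]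
        · exact hmesh i
        · exact sub_nonneg.2 (ht (Fin.castSucc_le_succ i))
    _ ≤ ε / (L + 1) * L := by
        rw [← Finset.mul_sum]
        exact mul_le_mul_of_nonneg_left (hsum m t ht) (by positivity)
    _ < ε := by
        rw [div_mul_eq_mul_div, div_lt_iff₀ (by positivity)]
        linarith

end AlgebraCalculus

theorem mainTheorem12 {A : Type*} [NormedGroupCommRing A] [NormedSpace ℝ A]
    [IsScalarTower ℝ A A] [SMulCommClass ℝ A A] [FiniteDimensional ℝ A]
    {U : Set A} (hUo : IsOpen U) (hUc : IsSimplyConnected U)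
    {f : A → A} (hf : ∀ p ∈ U, AlgDifferentiableAt f p) {ζ₀ : A} (hζ₀ : ζ₀ ∈ U) :
    (∀ ζ ∈ U, ∃ γ : Path ζ₀ ζ,
      ContDiffOn ℝ 1 γ.extend (Set.Icc 0 1) ∧ IsRectifiable γ ∧ CurveIn γ U) ∧
    ∃ F : A → A,
      (∀ ζ ∈ U, ∀ γ : Path ζ₀ ζ, IsRectifiable γ → CurveIn γ U →
        HasCurveIntegral f γ (F ζ)) ∧
      ∀ ζ ∈ U, HasAlgDerivAt F (f ζ) ζ := by
  refine ⟨fun ζ hζ ↦ exists_path_contDiffOn hUc.isPathConnected.isConnected.isPreconnected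
    hUo hζ₀ hζ, ?_⟩
  obtain ⟨F, hF⟩ := hUc.exists_forall_hasFDerivAt hUo (ω := fun x ↦ continuousMul A (f x))
    fun x hx ↦ by
      obtain ⟨r, hr, hrU⟩ := Metric.isOpen_iff.1 hUo x hx
      exact ⟨r, hr, exists_hasFDerivAt_continuousMul_of_ball fun p hp ↦ hf p (hrU hp)⟩
  -- Strictness is needed because both endpoints of a chord vary.
  have hstrict (x) (hx : x ∈ U) : HasStrictFDerivAt F (continuousMul A (f x)) x := by
    refine hasStrictFDerivAt_of_hasFDerivAt_of_continuousAt ?_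
      ((continuousMul A).continuous.continuousAt.comp (hf x hx).continuousAt)
    filter_upwards [hUo.mem_nhds hx] with y hy using hF y hy
  refine ⟨fun ζ ↦ F ζ - F ζ₀, fun ζ _ γ hγ hγU ↦ ?_, fun ζ hζ ↦ ?_⟩
  · exact hasCurveIntegral_of_hasStrictFDerivAt hγ (fun t ↦ hstrict _ (hγU t))
      fun t ↦ (hf _ (hγU t)).continuousAt
  · exact hasAlgDerivAt_of_hasFDerivAt ((hF ζ hζ).sub_const (F ζ₀))
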